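/- Let $A$ be a finite or countable alphabet and let $A^*$ be the free monoid of words over $A$, with empty word $\varepsilon$. Let $\theta : A^* \to A^*$ be a literal (anti)morphism onto $A^*$, that is, a bijection of $A^*$ onto itself such that $\theta(a) \in A$ for every letter $a \in A$, $\theta(\varepsilon) = \varepsilon$, and either $\theta(xy) = \theta(x)\theta(y)$ for all words $x, y$ or $\theta(xy) = \theta(y)\theta(x)$ for all words $x, y$. A word $u$ is a factor of a word $w$ if $w = puq$ for some words $p, q$; for $X \subseteq A^*$ let $F(X)$ be the set of the factors of the words of $X$, and let $X^*$ be the submonoid of $A^*$ generated by $X$. The set $X$ is thin if $F(X) \neq A^*$; complete if $F(X^*) = A^*$; $\theta$-invariant if $\theta(X) = X$; and a code if, for all $x_1, \dots, x_m, y_1, \dots, y_n \in X$, the equation $x_1 \cdots x_m = y_1 \cdots y_n$ implies $m = n$ and $x_i = y_i$ for every $i$. Theorem. Let $X \subseteq A^*$ be a thin $\theta$-invariant code. Then the following three conditions are equivalent: (i) $X$ is complete; (ii) $X$ is a maximal code, i.e. $X$ is maximal for inclusion in the family of all codes contained in $A^*$; (iii) $X$ is maximal for inclusion in the family of all $\theta$-invariant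 codes contained in $A^*$. -/

import Mathlib

namespace InvariantCodes

/-- `F(X)`: the set of all words that are a factor (contiguous subword) of some word of `X`.
Words over `A` are the elements of `List A`. -/
def factors {A : Type*} (X : Set (List A)) : Set (List A) :=
  {u | ∃ w ∈ X, u <:+: w}

/-- `X*`: the submonoid of `A*` generated by `X`, that is, the set of all finite (possibly empty)
concatenations of words of `X`. -/
def star {A : Type*} (X : Set (List A)) : Set (List A) :=
  (KStar.kstar (X : Language A) : Language A)

/-- `X` is thin if some word of `A*` is not a factor of any word of `X`. -/
def IsThin {A : Type*} (X : Set (List A)) : Prop :=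
  factors X ≠ Set.univ

/-- `X` is complete if every word of `A*` is a factor of some word of `X*`. -/
def IsComplete {A : Type*} (X : Set (List A)) : Prop :=
  factors (star X) = Set.univ

/-- `X` is a (variable length) code: two sequences of words of `X` with the same concatenation
are equal. -/
def IsCode {A : Type*} (X : Set (List A)) : Prop :=
  InformationTheory.UniquelyDecodable X

/-- `θ` is a literal (anti)morphism onto `A*`: a bijection of `A*` onto itself that maps letters to
letters and is a morphism or an antimorphism of monoids. -/
structure IsLiteralAntiMorphism {A : Type*} (θ : List A → List A) : Prop where
  bijective : Function.Bijective θ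
  literal : ∀ a : A, ∃ b : A, θ [a] = [b]
  map_nil : θ [] = []
  map_append : (∀ x y : List A, θ (x ++ y) = θ x ++ θ y) ∨
    (∀ x y : List A, θ (x ++ y) = θ y ++ θ x)

/-- `X` is `θ`-invariant if `θ(X) = X`. -/
def IsInvariant {A : Type*} (θ : List A → List A) (X : Set (List A)) : Prop :=
  θ '' X = X

end InvariantCodes

/-!
# Maximality and completeness of thin invariant codes

A thin complete code is maximal by a weight count. Choose a Bernoulli distribution on `A` which is
positive on every letter; this is possible because `A` is countable. A code has weight at most `1`
(`tsum_weight_le_one`, the Kraft–McMillan inequality): its free monoid embeds into `A*`, which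
bounds a geometric series. A thin complete set `X` has weight at least `1` (`one_le_tsum_weight`):
if `w` is a factor of no word of `X`, every word `u` can be completed to a word of `X*` by a suffix
and a prefix of `w`, so the infinite weight of `A*` is bounded by finitely many multiples of the
weight of `X*`, and the latter is finite if `X` has weight less than `1`. Adding a word to `X`
therefore violates the Kraft–McMillan inequality (`maximal_of_isComplete`).

Conversely, a `θ`-invariant code `X` that is not complete is contained in a larger `θ`-invariant
code (`isComplete_of_maximal`). If `A` has at least two letters, let `m` be the length of a word
outside `F(X*)` and add to `X` all words `cⁿ u eⁿ`, where `n = m + 1`, the word `u` of length `m` is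
not in `F(X*)`, and `c`, `e` differ from the first and last letter of `u` respectively. Taking all
such words, rather than the orbit of one of them, makes invariance immediate, for morphisms and
antimorphisms alike. Two of these words may overlap, but only within their frames
(`eq_nil_of_framed_overlap`), and the core `u` cannot lie in a word of `X*`; so two factorizations
of the same word have their first framed block in common, which gives the code property by
induction (`isCode_union_framed`). Alphabets with at most one letter are treated directly.
-/

namespace InvariantCodes

open scoped ENNReal
open Filter Topology

variable {A : Type*}

/-! ### The submonoid generated by a set of words and its factors -/

lemma mem_star {X : Set (List A)} {w : List A} :
    w ∈ star X ↔ ∃ L : List (List A), w = L.flatten ∧ ∀ y ∈ L, y ∈ X :=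
  Language.mem_kstar

lemma flatten_mem_star {X : Set (List A)} {L : List (List A)} (h : ∀ y ∈ L, y ∈ X) :
    L.flatten ∈ star X :=
  mem_star.2 ⟨L, rfl, h⟩

lemma nil_mem_star (X : Set (List A)) : [] ∈ star X :=
  flatten_mem_star (L := []) (by simp)

lemma append_mem_star {X : Set (List A)} {u v : List A} (hu : u ∈ star X) (hv : v ∈ star X) :
    u ++ v ∈ star X := by
  obtain ⟨L, rfl, hL⟩ := mem_star.1 hu
  obtain ⟨M, rfl, hM⟩ := mem_star.1 hv
  rw [← List.flatten_append]
  refine flatten_mem_star fun y hy => ?_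
  rcases List.mem_append.1 hy with h | h
  exacts [hL y h, hM y h]

lemma subset_star (X : Set (List A)) : X ⊆ star X := fun x hx => by
  simpa using flatten_mem_star (X := X) (L := [x]) (by simpa using hx)

/-- A word that is a factor of no word of `X` cannot fit inside a single block: wherever it occurs
in a word of `star X`, the factorization into words of `X` has a cut inside that occurrence. -/
lemma exists_cut {X : Set (List A)} {w : List A} (hw : w ∉ factors X) {p q : List A}
    (h : p ++ w ++ q ∈ star X) : ∃ s t, w = s ++ t ∧ p ++ s ∈ star X ∧ t ++ q ∈ star X := by
  obtain ⟨L, hL, hX⟩ := mem_star.1 h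
  clear h
  induction L generalizing p with
  | nil =>
    simp only [List.flatten_nil, List.append_eq_nil_iff] at hL
    obtain ⟨⟨rfl, rfl⟩, rfl⟩ := hL
    exact ⟨[], [], rfl, nil_mem_star X, nil_mem_star X⟩
  | cons x L ih =>
    have hx : x ∈ X := hX x (by simp)
    have hX' : ∀ y ∈ L, y ∈ X := fun y hy => hX y (by simp [hy])
    rw [List.flatten_cons, List.append_assoc] at hL
    rcases List.append_eq_append_iff.1 hL with ⟨v, hv, hv'⟩ | ⟨p', rfl, hp'⟩
    · rcases List.append_eq_append_iff.1 hv' with ⟨z, rfl, -⟩ | ⟨t, rfl, ht⟩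
      · exact absurd ⟨x, hx, p, z, by rw [hv, List.append_assoc]⟩ hw
      · exact ⟨v, t, rfl, by rw [← hv]; exact subset_star X hx,
          by rw [← ht]; exact flatten_mem_star hX'⟩
    · obtain ⟨s, t, hst, hs, ht⟩ := ih (p := p') (by rw [hp', List.append_assoc]) hX'
      exact ⟨s, t, hst, by rw [List.append_assoc]; exact append_mem_star (subset_star X hx) hs, ht⟩

/-! ### Multiplicative weights of words -/

/-- The multiplicative extension to words of a weight function `μ` on letters. When `μ` sums
to `1` this is a Bernoulli distribution. -/
noncomputable def weight (μ : A → ℝ≥0∞) (w : List A) : ℝ≥0∞ := (w.map μ).prod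

lemma weight_append (μ : A → ℝ≥0∞) (u v : List A) :
    weight μ (u ++ v) = weight μ u * weight μ v := by simp [weight]

lemma weight_flatten (μ : A → ℝ≥0∞) (L : List (List A)) :
    weight μ L.flatten = (L.map (weight μ)).prod := by
  induction L with
  | nil => simp [weight]
  | cons x L ih => rw [List.flatten_cons, weight_append, ih]; simp

lemma weight_const_mul (r : ℝ≥0∞) (μ : A → ℝ≥0∞) (w : List A) :
    weight (fun a => r * μ a) w = r ^ w.length * weight μ w := by
  induction w with
  | nil => simp [weight]
  | cons a w ih =>
    simp only [weight, List.map_cons, List.prod_cons, List.length_cons] at ih ⊢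
    rw [ih]; ring

lemma weight_ne_zero {μ : A → ℝ≥0∞} (h : ∀ a, μ a ≠ 0) (w : List A) : weight μ w ≠ 0 := by
  induction w with
  | nil => simp [weight]
  | cons a w ih =>
    simp only [weight, List.map_cons, List.prod_cons] at ih ⊢
    exact mul_ne_zero (h a) ih

lemma weight_le_one {μ : A → ℝ≥0∞} (h : ∀ a, μ a ≤ 1) (w : List A) : weight μ w ≤ 1 := by
  induction w with
  | nil => simp [weight]
  | cons a w ih =>
    simp only [weight, List.map_cons, List.prod_cons] at ih ⊢
    exact mul_le_one' (h a) ih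

lemma tsum_fin_prod {B : Type*} (g : B → ℝ≥0∞) (n : ℕ) :
    ∑' f : Fin n → B, ∏ i, g (f i) = (∑' b, g b) ^ n := by
  induction n with
  | zero => simp
  | succ n ih =>
    rw [← (Fin.consEquiv fun _ : Fin (n + 1) => B).tsum_eq, ENNReal.tsum_prod', pow_succ', ← ih,
      ← ENNReal.tsum_mul_right]
    simp [Fin.consEquiv, Fin.prod_univ_succ, ENNReal.tsum_mul_left]

lemma tsum_list_prod {B : Type*} (g : B → ℝ≥0∞) :
    ∑' L : List B, (L.map g).prod = ∑' n : ℕ, (∑' b, g b) ^ n := by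
  rw [← List.equivSigmaTuple.symm.tsum_eq, ENNReal.tsum_sigma']
  refine tsum_congr fun n => ?_
  rw [← tsum_fin_prod]
  refine tsum_congr fun f => ?_
  simp [List.equivSigmaTuple, List.prod_ofFn, List.map_ofFn]

lemma tsum_weight_flatten (μ : A → ℝ≥0∞) (Z : Set (List A)) :
    ∑' L : List Z, weight μ (L.map Subtype.val).flatten = ∑' n : ℕ, (∑' z : Z, weight μ z) ^ n := by
  rw [← tsum_list_prod]
  refine tsum_congr fun L => ?_
  rw [weight_flatten, List.map_map]
  rfl

/-- If the letters have total weight less than `1`, then so does a code: the free monoid on the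
code embeds into the free monoid on the letters, whose total weight is a finite geometric
series. -/
lemma tsum_weight_lt_one {Z : Set (List A)} (hZ : IsCode Z) {μ : A → ℝ≥0∞} (hμ : ∑' a, μ a < 1) :
    ∑' z : Z, weight μ z < 1 := by
  have hinj : Function.Injective fun L : List Z => (L.map Subtype.val).flatten := by
    intro L M h
    refine List.map_injective_iff.2 Subtype.val_injective (hZ _ _ ?_ ?_ h)
    · intro w hw; obtain ⟨z, -, rfl⟩ := List.mem_map.1 hw; exact z.2
    · intro w hw; obtain ⟨z, -, rfl⟩ := List.mem_map.1 hw; exact z.2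
  have h := ENNReal.tsum_comp_le_tsum_of_injective hinj (weight μ)
  rw [tsum_weight_flatten] at h
  have h2 : ∑' w : List A, weight μ w = (1 - ∑' a, μ a)⁻¹ := by
    rw [← ENNReal.tsum_geometric, ← tsum_list_prod]; rfl
  rw [h2, ENNReal.tsum_geometric] at h
  by_contra! hc
  rw [tsub_eq_zero_of_le hc, ENNReal.inv_zero, top_le_iff, ENNReal.inv_eq_top,
    tsub_eq_zero_iff_le] at h
  exact absurd hμ (not_lt.2 h)

/-- The Kraft–McMillan inequality for Bernoulli distributions. -/
lemma tsum_weight_le_one {Z : Set (List A)} (hZ : IsCode Z) {μ : A → ℝ≥0∞} (hμ : ∑' a, μ a = 1) :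
    ∑' z : Z, weight μ z ≤ 1 := by
  have hle : ∀ a, μ a ≤ 1 := fun a => (ENNReal.le_tsum a).trans hμ.le
  rw [ENNReal.tsum_eq_iSup_sum]
  refine iSup_le fun S => ?_
  -- Scale the weights by `r < 1` and let `r` tend to `1`.
  have hlim : Tendsto (fun r : ℝ≥0∞ => ∑ z ∈ S, r ^ (z : List A).length * weight μ z) (𝓝[<] 1)
      (𝓝 (∑ z ∈ S, 1 ^ (z : List A).length * weight μ z)) := by
    refine Tendsto.mono_left ?_ nhdsWithin_le_nhds
    refine tendsto_finsetSum _ fun z _ => ?_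
    refine ENNReal.Tendsto.mul_const ((ENNReal.continuous_pow _).tendsto 1) (Or.inr ?_)
    exact ne_top_of_le_ne_top ENNReal.one_ne_top (weight_le_one hle _)
  simp only [one_pow, one_mul] at hlim
  have : (𝓝[<] (1 : ℝ≥0∞)).NeBot := nhdsLT_neBot_of_exists_lt ⟨0, one_pos⟩
  refine le_of_tendsto hlim (eventually_nhdsWithin_of_forall fun r hr => ?_)
  simp_rw [← weight_const_mul]
  refine (ENNReal.sum_le_tsum S).trans (tsum_weight_lt_one hZ ?_).le
  rw [ENNReal.tsum_mul_left, hμ, mul_one]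
  exact hr

/-- A thin complete set has weight at least `1`: surrounding an arbitrary word by suffixes and
prefixes of a fixed word `w ∉ factors X` gives a word of `star X`, so finitely many copies of
`star X` cover the infinite total weight of all words. -/
lemma one_le_tsum_weight {X : Set (List A)} (hthin : IsThin X) (hcomp : IsComplete X)
    {μ : A → ℝ≥0∞} (hμ : ∑' a, μ a = 1) (hpos : ∀ a, μ a ≠ 0) :
    1 ≤ ∑' x : X, weight μ x := by
  obtain ⟨w, hw⟩ := (Set.ne_univ_iff_exists_notMem _).1 hthin
  have hle : ∀ a, μ a ≤ 1 := fun a => (ENNReal.le_tsum a).trans hμ.le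
  have hcut : ∀ u : List A, ∃ (k : Fin (w.length + 1) × Fin (w.length + 1)) (L : List X),
      w.drop k.1 ++ u ++ w.take k.2 = (L.map Subtype.val).flatten := by
    intro u
    have hu : w ++ u ++ w ∈ factors (star X) := hcomp ▸ Set.mem_univ _
    obtain ⟨v, hv, p, q, rfl⟩ := hu
    obtain ⟨s, t, hst, -, ht⟩ := exists_cut hw (p := p) (q := u ++ w ++ q) (by simpa using hv)
    obtain ⟨s', t', hst', hs', -⟩ := exists_cut hw (p := t ++ u) (q := q) (by simpa using ht)
    obtain ⟨L, hL, hLX⟩ := mem_star.1 hs'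
    lift L to List X using hLX
    refine ⟨(⟨s.length, ?_⟩, ⟨s'.length, ?_⟩), L, ?_⟩
    · rw [hst]; simp
    · rw [hst']; simp
    · have h1 : w.drop s.length = t := by rw [hst]; simp
      have h2 : w.take s'.length = s' := by rw [hst']; simp
      simp only [h1, h2, hL]
  choose k L hkL using hcut
  have hinj : Function.Injective fun u => (k u, L u) := by
    intro u v h
    simp only [Prod.mk.injEq] at h
    have := (hkL u).trans ((congrArg (fun L : List X => (L.map Subtype.val).flatten) h.2).trans (hkL v).symm)
    simp only [h.1] at this
    exact List.append_cancel_left (List.append_cancel_right this)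
  have hbound : ∀ u, weight μ w * weight μ w * weight μ u ≤
      weight μ ((L u).map Subtype.val).flatten := by
    intro u
    have h1 : weight μ w ≤ weight μ (w.drop (k u).1) := by
      conv_lhs => rw [← List.take_append_drop (k u).1 w, weight_append]
      exact mul_le_of_le_one_left' (weight_le_one hle _)
    have h2 : weight μ w ≤ weight μ (w.take (k u).2) := by
      conv_lhs => rw [← List.take_append_drop (k u).2 w, weight_append]
      exact mul_le_of_le_one_right' (weight_le_one hle _)
    rw [← hkL u, weight_append, weight_append, mul_right_comm]
    gcongr
  by_contra! hlt
  have htop : ∑' u : List A, weight μ u = ∞ := by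
    have := tsum_list_prod μ
    rw [hμ, ENNReal.tsum_geometric] at this
    simpa [weight] using this
  have hfin : ∑' L : List X, weight μ (L.map Subtype.val).flatten ≠ ∞ := by
    rw [tsum_weight_flatten, ENNReal.tsum_geometric]
    exact ENNReal.inv_ne_top.2 (tsub_pos_of_lt hlt).ne'
  have hchain : weight μ w * weight μ w * ∑' u : List A, weight μ u ≤
      ∑' _ : Fin (w.length + 1) × Fin (w.length + 1),
        ∑' L : List X, weight μ (L.map Subtype.val).flatten := by
    rw [← ENNReal.tsum_mul_left, ← ENNReal.tsum_prod]
    exact (ENNReal.tsum_le_tsum hbound).trans (ENNReal.tsum_comp_le_tsum_of_injective hinj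
      fun x => weight μ (x.2.map Subtype.val).flatten)
  rw [htop, ENNReal.mul_top (mul_ne_zero (weight_ne_zero hpos w) (weight_ne_zero hpos w)),
    top_le_iff, tsum_fintype, Finset.sum_const, nsmul_eq_mul] at hchain
  exact ENNReal.mul_ne_top (ENNReal.natCast_ne_top _) hfin hchain

lemma exists_tsum_eq_one (A : Type*) [Countable A] [Nonempty A] :
    ∃ μ : A → ℝ≥0∞, ∑' a, μ a = 1 ∧ ∀ a, μ a ≠ 0 := by
  obtain ⟨ν, hν, hsum⟩ := ENNReal.exists_pos_sum_of_countable' one_ne_zero A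
  have h0 : ∑' a, ν a ≠ 0 := fun h =>
    (hν (Classical.arbitrary A)).ne' (ENNReal.tsum_eq_zero.1 h _)
  have htop : ∑' a, ν a ≠ ∞ := hsum.ne_top
  refine ⟨fun a => ν a * (∑' a, ν a)⁻¹, ?_, fun a => ?_⟩
  · rw [ENNReal.tsum_mul_right, ENNReal.mul_inv_cancel h0 htop]
  · exact mul_ne_zero (hν a).ne' (ENNReal.inv_ne_zero.2 htop)

/-- A thin complete code is maximal, because adding a word would push its weight above `1`. -/
theorem maximal_of_isComplete [Countable A] {X : Set (List A)} (hthin : IsThin X)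
    (hcode : IsCode X) (hcomp : IsComplete X) : Maximal (fun Y : Set (List A) => IsCode Y) X := by
  refine ⟨hcode, fun Z hZ hXZ y hyZ => ?_⟩
  rcases isEmpty_or_nonempty A with hA | hA
  · exact absurd (Subsingleton.elim y [] ▸ hyZ) hZ.epsilon_not_mem
  by_contra hyX
  obtain ⟨μ, hμ, hpos⟩ := exists_tsum_eq_one A
  have h1 := one_le_tsum_weight hthin hcomp hμ hpos
  have hsub : insert y X ⊆ Z := Set.insert_subset hyZ hXZ
  have h2 := (ENNReal.tsum_mono_subtype (weight μ) hsub).trans (tsum_weight_le_one hZ hμ)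
  rw [Set.insert_eq, ENNReal.summable.tsum_union_disjoint (by simpa using hyX) ENNReal.summable,
    tsum_singleton y (weight μ)] at h2
  have h3 : 1 < weight μ y + ∑' x : X, weight μ x := by
    rw [add_comm]
    exact h1.trans_lt (ENNReal.lt_add_right
      (ne_top_of_le_ne_top ENNReal.one_ne_top (tsum_weight_le_one hcode hμ)) (weight_ne_zero hpos y))
  exact absurd h2 (not_le.2 h3)

/-! ### Literal (anti)morphisms -/

lemma mem_factors_of_infix {X : Set (List A)} {u v : List A} (huv : u <:+: v)
    (hv : v ∈ factors X) : u ∈ factors X := by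
  obtain ⟨w, hw, h⟩ := hv
  exact ⟨w, hw, huv.trans h⟩

lemma nil_mem_factors_star (X : Set (List A)) : [] ∈ factors (star X) :=
  ⟨[], nil_mem_star X, List.infix_rfl⟩

lemma IsLiteralAntiMorphism.exists_map {θ : List A → List A} (hθ : IsLiteralAntiMorphism θ) :
    ∃ σ : A → A, Function.Injective σ ∧
      ((∀ w, θ w = w.map σ) ∨ ∀ w, θ w = (w.map σ).reverse) := by
  choose σ hσ using hθ.literal
  refine ⟨σ, fun a b hab => ?_, ?_⟩
  · have : θ [a] = θ [b] := by rw [hσ, hσ, hab]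
    simpa using hθ.bijective.1 this
  · rcases hθ.map_append with h | h
    · refine Or.inl fun w => ?_
      induction w with
      | nil => simp [hθ.map_nil]
      | cons a w ih => rw [← List.singleton_append, h, hσ, ih]; simp
    · refine Or.inr fun w => ?_
      induction w with
      | nil => simp [hθ.map_nil]
      | cons a w ih => rw [← List.singleton_append, h, hσ, ih]; simp

lemma IsLiteralAntiMorphism.exists_inverse {θ : List A → List A} (hθ : IsLiteralAntiMorphism θ) :
    ∃ η : List A → List A, IsLiteralAntiMorphism η ∧
      Function.LeftInverse η θ ∧ Function.RightInverse η θ := by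
  obtain ⟨η, hl, hr⟩ := Function.bijective_iff_has_inverse.1 hθ.bijective
  refine ⟨η, ⟨⟨hr.injective, hl.surjective⟩, fun a => ?_, ?_, ?_⟩, hl, hr⟩
  · obtain ⟨σ, -, h⟩ := hθ.exists_map
    have hlen : (η [a]).length = 1 := by
      have h1 : (θ (η [a])).length = 1 := by rw [hr]; rfl
      rcases h with h | h <;> simpa [h] using h1
    exact List.length_eq_one_iff.1 hlen
  · simpa [hθ.map_nil] using hl []
  · rcases hθ.map_append with h | h
    · exact Or.inl fun x y => hθ.bijective.1 (by rw [h, hr, hr, hr])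
    · exact Or.inr fun x y => hθ.bijective.1 (by rw [h, hr, hr, hr])

lemma IsLiteralAntiMorphism.mapsTo_factors_star {θ : List A → List A}
    (hθ : IsLiteralAntiMorphism θ) {X : Set (List A)} (hX : Set.MapsTo θ X X) :
    Set.MapsTo θ (factors (star X)) (factors (star X)) := by
  rintro u ⟨w, hw, p, q, rfl⟩
  obtain ⟨L, hL, hLX⟩ := mem_star.1 hw
  refine ⟨θ (p ++ u ++ q), ?_, ?_⟩
  · rw [hL]
    clear hL hw
    induction L with
    | nil => rw [List.flatten_nil, hθ.map_nil]; exact nil_mem_star X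
    | cons x L ih =>
      have hx := subset_star X (hX (hLX x (by simp)))
      have hL := ih fun y hy => hLX y (by simp [hy])
      rw [List.flatten_cons]
      rcases hθ.map_append with h | h <;> rw [h]
      exacts [append_mem_star hx hL, append_mem_star hL hx]
  · rcases hθ.map_append with h | h <;> rw [h, h]
    · exact ⟨θ p, θ q, rfl⟩
    · exact ⟨θ q, θ p, by simp⟩

/-! ### Framed words -/

/-- The words `cⁿ u eⁿ`, where `u` is a word of length `m` outside `S` that does not begin with the
letter `c` and does not end with the letter `e`. The frames have length `n = m + 1`, longer
than `u`. -/
def framed (S : Set (List A)) (m : ℕ) : Set (List A) :=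
  {t | ∃ (c e : A) (u : List A),
    t = List.replicate (m + 1) c ++ u ++ List.replicate (m + 1) e ∧ u.length = m ∧ u ∉ S ∧
      u.head? ≠ some c ∧ u.getLast? ≠ some e}

lemma IsLiteralAntiMorphism.mapsTo_framed {θ : List A → List A} (hθ : IsLiteralAntiMorphism θ)
    {S : Set (List A)} (hS : Set.MapsTo θ Sᶜ Sᶜ) (m : ℕ) :
    Set.MapsTo θ (framed S m) (framed S m) := by
  rintro t ⟨c, e, u, rfl, hm, hu, hc, he⟩
  obtain ⟨σ, hσ, h | h⟩ := hθ.exists_map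
  · refine ⟨σ c, σ e, θ u, by simp [h], by simp [h, hm], hS hu, ?_, ?_⟩
    · rw [h, List.head?_map, ← Option.map_some]
      exact fun H => hc (Option.map_injective hσ H)
    · rw [h, List.getLast?_map, ← Option.map_some]
      exact fun H => he (Option.map_injective hσ H)
  · refine ⟨σ e, σ c, θ u, by simp [h], by simp [h, hm], hS hu, ?_, ?_⟩
    · rw [h, List.head?_reverse, List.getLast?_map, ← Option.map_some]
      exact fun H => he (Option.map_injective hσ H)
    · rw [h, List.getLast?_reverse, List.head?_map, ← Option.map_some]
      exact fun H => hc (Option.map_injective hσ H)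

lemma length_of_mem_framed {S : Set (List A)} {m : ℕ} {t : List A} (ht : t ∈ framed S m) :
    t.length = m + 1 + m + (m + 1) := by
  obtain ⟨c, e, u, rfl, hm, -⟩ := ht
  simp [hm, add_assoc]

/-- An occurrence of a framed word that starts inside `cⁿ u` but not at the beginning of the framed
word `cⁿ u eⁿ` is impossible: its first `n` letters are equal, whereas the window of `n` letters
they occupy straddles a frame boundary, where two consecutive letters differ. -/
lemma eq_nil_of_framed_overlap {S : Set (List A)} (hS : [] ∈ S) {m : ℕ} {t t' v R R' : List A}
    (ht : t ∈ framed S m) (ht' : t' ∈ framed S m) (h : t ++ R = v ++ (t' ++ R'))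
    (hv : v.length < m + 1 + m) : v = [] := by
  obtain ⟨c, e, u, rfl, hm, hu, hc, he⟩ := ht
  obtain ⟨c', e', u', rfl, -⟩ := ht'
  have hm0 : 0 < m := by
    rcases Nat.eq_zero_or_pos m with rfl | h0
    · exact absurd (List.length_eq_zero_iff.1 hm ▸ hS) hu
    · exact h0
  have hwin : ∀ i, v.length ≤ i → i < v.length + (m + 1) →
      (List.replicate (m + 1) c ++ u ++ List.replicate (m + 1) e ++ R)[i]? = some c' := by
    intro i h1 h2
    rw [h, List.getElem?_append_right h1, List.append_assoc, List.append_assoc,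
      List.getElem?_append_left (by simp; omega), List.getElem?_replicate, if_pos (by omega)]
  by_contra hne
  have hpos := List.length_pos_iff.2 hne
  simp only [List.append_assoc] at hwin
  rcases lt_or_ge v.length (m + 1) with hlt | hge
  · have h1 := hwin m (by omega) (by omega)
    have h2 := hwin (m + 1) (by omega) (by omega)
    rw [List.getElem?_append_left (by simp), List.getElem?_replicate, if_pos (by omega)] at h1
    rw [List.getElem?_append_right (by simp), List.length_replicate, Nat.sub_self,
      List.getElem?_append_left (by omega), ← List.head?_eq_getElem?, ← h1] at h2
    exact hc h2
  · have h1 := hwin (m + m) (by omega) (by omega)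
    have h2 := hwin (m + 1 + m) (by omega) (by omega)
    rw [List.getElem?_append_right (by simp; omega), List.length_replicate,
      List.getElem?_append_left (by omega), show m + m - (m + 1) = u.length - 1 by omega,
      ← List.getLast?_eq_getElem?] at h1
    rw [List.getElem?_append_right (by simp), List.length_replicate,
      List.getElem?_append_right (by omega), List.getElem?_append_left (by simp [hm]),
      List.getElem?_replicate, if_pos (by omega), ← h1] at h2
    exact he h2.symm

lemma exists_first_of_not_forall {X T : Set (List A)} {L : List (List A)}
    (hL : ∀ w ∈ L, w ∈ X ∪ T) (h : ¬ ∀ w ∈ L, w ∈ X) :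
    ∃ P t R, L = P ++ t :: R ∧ (∀ w ∈ P, w ∈ X) ∧ t ∈ T ∧ ∀ w ∈ R, w ∈ X ∪ T := by
  induction L with
  | nil => simp at h
  | cons x L ih =>
    have hL' : ∀ w ∈ L, w ∈ X ∪ T := fun w hw => hL w (by simp [hw])
    by_cases hx : x ∈ X
    · obtain ⟨P, t, R, rfl, hP, ht, hR⟩ := ih hL' fun H => h (by simpa [hx] using H)
      exact ⟨x :: P, t, R, rfl, by simpa [hx] using hP, ht, hR⟩
    · exact ⟨[], x, L, rfl, by simp, (hL x (by simp)).resolve_left hx, hL'⟩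

lemma not_mem_factors_of_mem_framed {X : Set (List A)} {m : ℕ} {t : List A}
    (ht : t ∈ framed (factors (star X)) m) : t ∉ factors (star X) := by
  obtain ⟨c, e, u, rfl, -, hu, -⟩ := ht
  exact fun H => hu (mem_factors_of_infix ⟨_, _, rfl⟩ H)

/-- In two factorizations of the same word, the first framed blocks start at the same position:
otherwise the later one would either overlap the earlier one, or leave the core of the earlier one
inside a word of `star X`. This is half of the comparison. -/
lemma eq_nil_of_first_framed {X : Set (List A)} {m : ℕ} {P' t t' v R R' : List A}
    (hP' : P' ∈ star X) (ht : t ∈ framed (factors (star X)) m)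
    (ht' : t' ∈ framed (factors (star X)) m) (hv : v <:+ P')
    (h : t ++ R = v ++ (t' ++ R')) : v = [] := by
  refine eq_nil_of_framed_overlap (nil_mem_factors_star X) ht ht' h ?_
  by_contra! hlen
  obtain ⟨c, e, u, rfl, hm, hu, -⟩ := ht
  have hpre : List.replicate (m + 1) c ++ u <+: v := by
    refine List.prefix_of_prefix_length_le (l₃ := v ++ (t' ++ R')) ?_ (List.prefix_append _ _)
      (by simp [hm]; omega)
    rw [← h, List.append_assoc (_ ++ u)]
    exact List.prefix_append _ _
  exact hu ⟨P', hP',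
    (List.suffix_append _ u).isInfix.trans (hpre.isInfix.trans hv.isInfix)⟩

/-- Adding to a code `X` the framed words with core outside `factors (star X)` gives a code. -/
lemma isCode_union_framed {X : Set (List A)} (hX : IsCode X) (m : ℕ) :
    IsCode (X ∪ framed (factors (star X)) m) := by
  intro L
  induction hn : L.length using Nat.strong_induction_on generalizing L with
  | _ n ih =>
  subst hn
  intro M hL hM h
  have hpure : ∀ {L M : List (List A)}, (∀ w ∈ L, w ∈ X) →
      (∀ w ∈ M, w ∈ X ∪ framed (factors (star X)) m) → L.flatten = M.flatten →
      ∀ w ∈ M, w ∈ X := by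
    intro L M hL hM h w hw
    refine (hM w hw).resolve_right fun hT => not_mem_factors_of_mem_framed hT ?_
    obtain ⟨s, t, rfl⟩ := List.append_of_mem hw
    exact ⟨L.flatten, flatten_mem_star hL, s.flatten, t.flatten, by simp [h]⟩
  by_cases hLX : ∀ w ∈ L, w ∈ X
  · exact hX L M hLX (hpure hLX hM h) h
  have hMX : ¬ ∀ w ∈ M, w ∈ X := fun hMX => hLX (hpure hMX hL h.symm)
  obtain ⟨P, t, R, rfl, hP, ht, hR⟩ := exists_first_of_not_forall hL hLX
  obtain ⟨P', t', R', rfl, hP', ht', hR'⟩ := exists_first_of_not_forall hM hMX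
  simp only [List.flatten_append, List.flatten_cons] at h
  have hPP : P.flatten = P'.flatten := by
    rcases List.append_eq_append_iff.1 h with ⟨v, hv, hv'⟩ | ⟨v, hv, hv'⟩
    · have := eq_nil_of_first_framed (flatten_mem_star hP') ht ht' ⟨_, hv.symm⟩ hv'
      simpa [this] using hv.symm
    · have := eq_nil_of_first_framed (flatten_mem_star hP) ht' ht ⟨_, hv.symm⟩ hv'
      simpa [this] using hv
  rw [hPP] at h
  obtain ⟨rfl, hRR⟩ := List.append_inj (List.append_cancel_left h)
    ((length_of_mem_framed ht).trans (length_of_mem_framed ht').symm)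
  rw [hX P P' hP hP' hPP, ih R.length (by simp; omega) R rfl R' hR hR' hRR]

/-! ### Incomplete invariant codes are not maximal -/

lemma isComplete_of_subsingleton [Subsingleton A] {X : Set (List A)} {x : List A} (hx : x ∈ X)
    (hx0 : x ≠ []) : IsComplete X := by
  refine Set.eq_univ_of_forall fun w => ⟨(List.replicate w.length x).flatten,
    flatten_mem_star fun y hy => (List.eq_of_mem_replicate hy) ▸ hx, ?_⟩
  have hlen : w.length ≤ (List.replicate w.length x).flatten.length := by
    simpa using Nat.le_mul_of_pos_right _ (List.length_pos_iff.2 hx0)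
  have hw : w = (List.replicate w.length x).flatten.take w.length :=
    List.ext_getElem (by simpa using hlen) fun _ _ _ => Subsingleton.elim _ _
  have hpre : w <+: (List.replicate w.length x).flatten := by
    conv_lhs => rw [hw]
    exact List.take_prefix _ _
  exact hpre.isInfix

lemma isCode_singleton_letter (a : A) : IsCode ({[a]} : Set (List A)) := by
  intro L M hL hM h
  rw [List.eq_replicate_of_mem hL, List.eq_replicate_of_mem hM] at h ⊢
  simpa using congrArg List.length h

theorem isComplete_of_maximal {θ : List A → List A} (hθ : IsLiteralAntiMorphism θ)
    {X : Set (List A)}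
    (hmax : Maximal (fun Y : Set (List A) => IsCode Y ∧ IsInvariant θ Y) X) : IsComplete X := by
  obtain ⟨⟨hcode, hinv⟩, hmax⟩ := hmax
  by_contra hcomp
  obtain ⟨w, hw⟩ := (Set.ne_univ_iff_exists_notMem _).1 hcomp
  have hw0 : w ≠ [] := fun h => hw (h ▸ nil_mem_factors_star X)
  rcases subsingleton_or_nontrivial A with hA | hA
  · -- Over a single letter `a`, an incomplete code is empty and `{[a]}` is larger.
    have hX : ∀ x, x ∉ X := fun x hx =>
      hcomp (isComplete_of_subsingleton hx fun h => hcode.epsilon_not_mem (h ▸ hx))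
    obtain ⟨a, -⟩ := List.exists_mem_of_ne_nil w hw0
    refine hX [a] (hmax ⟨isCode_singleton_letter a, ?_⟩ (fun x hx => absurd hx (hX x)) rfl)
    obtain ⟨b, hb⟩ := hθ.literal a
    rw [IsInvariant, Set.image_singleton, hb, Subsingleton.elim b a]
  · obtain ⟨η, hη, hl, hr⟩ := hθ.exists_inverse
    have hθX : Set.MapsTo θ X X := Set.mapsTo_iff_image_subset.2 hinv.subset
    have hηX : Set.MapsTo η X X := by
      intro x hx
      obtain ⟨y, hy, rfl⟩ := hinv.symm.subset hx
      rwa [hl y]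
    have hθS : Set.MapsTo θ (factors (star X))ᶜ (factors (star X))ᶜ := fun u hu H =>
      hu (hl u ▸ hη.mapsTo_factors_star hηX H)
    have hηS : Set.MapsTo η (factors (star X))ᶜ (factors (star X))ᶜ := fun u hu H =>
      hu (hr u ▸ hθ.mapsTo_factors_star hθX H)
    obtain ⟨c, hc⟩ := exists_ne (w.head hw0)
    obtain ⟨e, he⟩ := exists_ne (w.getLast hw0)
    have ht : List.replicate (w.length + 1) c ++ w ++ List.replicate (w.length + 1) e ∈
        framed (factors (star X)) w.length := by
      refine ⟨c, e, w, rfl, rfl, hw, ?_, ?_⟩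
      · rw [List.head?_eq_some_head hw0]
        exact fun h => hc (Option.some.inj h).symm
      · rw [List.getLast?_eq_some_getLast hw0]
        exact fun h => he (Option.some.inj h).symm
    refine not_mem_factors_of_mem_framed ht
      ⟨_, subset_star X (hmax ⟨isCode_union_framed hcode w.length, ?_⟩ Set.subset_union_left
        (Or.inr ht)), List.infix_rfl⟩
    rw [IsInvariant, Set.image_union, hinv]
    congr 1
    refine (hθ.mapsTo_framed hθS _).image_subset.antisymm fun t ht => ?_
    exact ⟨η t, hη.mapsTo_framed hηS _ ht, hr t⟩

end InvariantCodes

theorem theorem2 {A : Type*} [Countable A] (θ : List A → List A)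
    (hθ : InvariantCodes.IsLiteralAntiMorphism θ) (X : Set (List A))
    (hthin : InvariantCodes.IsThin X) (hcode : InvariantCodes.IsCode X)
    (hinv : InvariantCodes.IsInvariant θ X) :
    List.TFAE
      [InvariantCodes.IsComplete X,
        Maximal (fun Y : Set (List A) => InvariantCodes.IsCode Y) X,
        Maximal (fun Y : Set (List A) =>
          InvariantCodes.IsCode Y ∧ InvariantCodes.IsInvariant θ Y) X] := by
  tfae_have 1 → 2 := InvariantCodes.maximal_of_isComplete hthin hcode
  tfae_have 2 → 3 := fun h => ⟨⟨hcode, hinv⟩, fun _ hY => h.2 hY.1⟩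
  tfae_have 3 → 1 := InvariantCodes.isComplete_of_maximal hθ
  tfae_finish
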